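/- Let $\mathbb{K}$ be $\mathbb{R}$ or $\mathbb{C}$, let $X$ and $Y$ be Banach spaces over $\mathbb{K}$, and let $m\ge 2$. Let $\mathcal{P}(^mX;Y)$ be the space of continuous $m$-homogeneous polynomials from $X$ to $Y$, that is, of the maps $P(x)=A(x,\dots,x)$ with $A\colon X^m\to Y$ continuous and $m$-linear, with the norm $\|P\|=\sup\{\|P(x)\|:\|x\|\le 1\}$, and put $\mathcal{P}(^mX)=\mathcal{P}(^mX;\mathbb{K})$. The rank of $P\in\mathcal{P}(^mX;Y)$ is the dimension of the linear span of $P(X)$, and $P$ is compact if it maps the closed unit ball of $X$ to a relatively compact subset of $Y$. The adjoint of $P$ is the continuous linear operator $P^*\colon Y^*\to\mathcal{P}(^mX)$ given by $P^*(\varphi)(x)=\varphi(P(x))$. For $n\ge 1$ put $$\tilde a_n(P)=\inf\{\|P-Q\|:\ Q\in\mathcal{P}(^mX;Y),\ \operatorname{rank}(Q)<n\},$$ and for a continuous linear operator $T\colon E\to F$ between Banach spaces put $$a_n(T)=\inf\{\|T-L\|:\ L\colon E\to F \text{ continuous and linear},\ \operatorname{rank}(L)<n\}.$$ 1. If $P\in\mathcal{P}(^mX;Y)$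 is compact, then $\tilde a_n(P)=a_n(P^*)$ for every $n\ge 1$. 2. For every $P\in\mathcal{P}(^mX;Y)$ and every $n\ge 1$, $\tilde a_n(P)\le 5\,a_n(P^*)$. -/

import Mathlib

/-- The space `𝒫(ᵐX; Y)` of continuous `m`-homogeneous polynomials from `X` to `Y`: the maps
`x ↦ A (x, …, x)` where `A` is a continuous `m`-linear map. -/
structure HomPoly (𝕜 : Type*) [RCLike 𝕜] (m : ℕ) (X Y : Type*)
    [NormedAddCommGroup X] [NormedSpace 𝕜 X] [NormedAddCommGroup Y] [NormedSpace 𝕜 Y] where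
  toFun : X → Y
  exists_multilinear' : ∃ A : ContinuousMultilinearMap 𝕜 (fun _ : Fin m => X) Y,
    ∀ x, toFun x = A (fun _ => x)

namespace HomPoly

variable {𝕜 : Type*} [RCLike 𝕜] {m : ℕ} {X Y : Type*}
  [NormedAddCommGroup X] [NormedSpace 𝕜 X] [NormedAddCommGroup Y] [NormedSpace 𝕜 Y]

instance : FunLike (HomPoly 𝕜 m X Y) X Y where
  coe := toFun
  coe_injective P Q h := by cases P; cases Q; congr

theorem exists_multilinear (P : HomPoly 𝕜 m X Y) :
    ∃ A : ContinuousMultilinearMap 𝕜 (fun _ : Fin m => X) Y, ∀ x, P x = A (fun _ => x) :=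
  P.exists_multilinear'

instance : Zero (HomPoly 𝕜 m X Y) := ⟨⟨fun _ => 0, 0, fun _ => rfl⟩⟩

instance : Add (HomPoly 𝕜 m X Y) :=
  ⟨fun P Q => ⟨fun x => P x + Q x, by
    obtain ⟨A, hA⟩ := P.exists_multilinear
    obtain ⟨B, hB⟩ := Q.exists_multilinear
    exact ⟨A + B, fun x => by simp [hA, hB]⟩⟩⟩

instance : Neg (HomPoly 𝕜 m X Y) :=
  ⟨fun P => ⟨fun x => -P x, by
    obtain ⟨A, hA⟩ := P.exists_multilinear
    exact ⟨-A, fun x => by simp [hA]⟩⟩⟩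

instance : Sub (HomPoly 𝕜 m X Y) :=
  ⟨fun P Q => ⟨fun x => P x - Q x, by
    obtain ⟨A, hA⟩ := P.exists_multilinear
    obtain ⟨B, hB⟩ := Q.exists_multilinear
    exact ⟨A - B, fun x => by simp [hA, hB]⟩⟩⟩

instance : SMul 𝕜 (HomPoly 𝕜 m X Y) :=
  ⟨fun c P => ⟨fun x => c • P x, by
    obtain ⟨A, hA⟩ := P.exists_multilinear
    exact ⟨c • A, fun x => by simp [hA]⟩⟩⟩

instance : SMul ℕ (HomPoly 𝕜 m X Y) :=
  ⟨fun c P => ⟨fun x => c • P x, by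
    obtain ⟨A, hA⟩ := P.exists_multilinear
    exact ⟨c • A, fun x => by simp [hA]⟩⟩⟩

instance : SMul ℤ (HomPoly 𝕜 m X Y) :=
  ⟨fun c P => ⟨fun x => c • P x, by
    obtain ⟨A, hA⟩ := P.exists_multilinear
    exact ⟨(c : 𝕜) • A, fun x => by simp [hA, Int.cast_smul_eq_zsmul]⟩⟩⟩

instance : AddCommGroup (HomPoly 𝕜 m X Y) :=
  DFunLike.coe_injective.addCommGroup (fun P : HomPoly 𝕜 m X Y => (P : X → Y))
    rfl (fun _ _ => rfl) (fun _ => rfl) (fun _ _ => rfl) (fun _ _ => rfl) (fun _ _ => rfl)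

/-- Evaluation, as an additive map into functions. -/
def coeAddHom : HomPoly 𝕜 m X Y →+ (X → Y) where
  toFun P := P
  map_zero' := rfl
  map_add' _ _ := rfl

instance : Module 𝕜 (HomPoly 𝕜 m X Y) :=
  DFunLike.coe_injective.module 𝕜 (coeAddHom : HomPoly 𝕜 m X Y →+ (X → Y)) (fun _ _ => rfl)

@[simp] theorem zero_apply (x : X) : (0 : HomPoly 𝕜 m X Y) x = 0 := rfl
@[simp] theorem add_apply (P Q : HomPoly 𝕜 m X Y) (x : X) : (P + Q) x = P x + Q x := rfl
@[simp] theorem neg_apply (P : HomPoly 𝕜 m X Y) (x : X) : (-P) x = -P x := rfl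
@[simp] theorem sub_apply (P Q : HomPoly 𝕜 m X Y) (x : X) : (P - Q) x = P x - Q x := rfl
@[simp] theorem smul_apply (c : 𝕜) (P : HomPoly 𝕜 m X Y) (x : X) : (c • P) x = c • P x := rfl

theorem map_smul (P : HomPoly 𝕜 m X Y) (c : 𝕜) (x : X) : P (c • x) = c ^ m • P x := by
  obtain ⟨A, hA⟩ := P.exists_multilinear
  have h := A.map_smul_univ (fun _ => c) (fun _ => x)
  simpa [hA] using h

/-- The norm `‖P‖ = sup {‖P x‖ : ‖x‖ ≤ 1}`. -/
noncomputable instance : Norm (HomPoly 𝕜 m X Y) :=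
  ⟨fun P => sSup {r : ℝ | ∃ x : X, ‖x‖ ≤ 1 ∧ r = ‖P x‖}⟩

theorem norm_def (P : HomPoly 𝕜 m X Y) :
    ‖P‖ = sSup {r : ℝ | ∃ x : X, ‖x‖ ≤ 1 ∧ r = ‖P x‖} := rfl

theorem bddAbove_norm (P : HomPoly 𝕜 m X Y) :
    BddAbove {r : ℝ | ∃ x : X, ‖x‖ ≤ 1 ∧ r = ‖P x‖} := by
  obtain ⟨A, hA⟩ := P.exists_multilinear
  refine ⟨‖A‖, ?_⟩
  rintro r ⟨x, hx, rfl⟩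
  rw [hA]
  exact A.unit_le_opNorm ((pi_norm_le_iff_of_nonneg zero_le_one).2 fun _ => hx)

theorem norm_apply_le (P : HomPoly 𝕜 m X Y) {x : X} (hx : ‖x‖ ≤ 1) : ‖P x‖ ≤ ‖P‖ :=
  le_csSup P.bddAbove_norm ⟨x, hx, rfl⟩

theorem norm_le_of_forall (P : HomPoly 𝕜 m X Y) {C : ℝ} (h : ∀ x, ‖x‖ ≤ 1 → ‖P x‖ ≤ C) :
    ‖P‖ ≤ C := by
  refine csSup_le ⟨‖P 0‖, 0, by simp, rfl⟩ ?_
  rintro r ⟨x, hx, rfl⟩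
  exact h x hx

theorem norm_nonneg' (P : HomPoly 𝕜 m X Y) : 0 ≤ ‖P‖ :=
  (norm_nonneg _).trans (P.norm_apply_le (x := 0) (by simp))

theorem normedSpaceCore : NormedSpace.Core 𝕜 (HomPoly 𝕜 m X Y) where
  norm_nonneg := norm_nonneg'
  norm_smul c P := by
    have key : ∀ (c : 𝕜) (P : HomPoly 𝕜 m X Y), ‖c • P‖ ≤ ‖c‖ * ‖P‖ := fun c P =>
      norm_le_of_forall _ fun x hx => by
        rw [smul_apply, norm_smul]
        exact mul_le_mul_of_nonneg_left (P.norm_apply_le hx) (norm_nonneg c)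
    refine le_antisymm (key c P) ?_
    by_cases hc : c = 0
    · subst hc
      simpa using norm_nonneg' ((0 : 𝕜) • P)
    · have h := key c⁻¹ (c • P)
      rw [inv_smul_smul₀ hc, norm_inv] at h
      have hc' : 0 < ‖c‖ := norm_pos_iff.2 hc
      calc ‖c‖ * ‖P‖ ≤ ‖c‖ * (‖c‖⁻¹ * ‖c • P‖) := mul_le_mul_of_nonneg_left h hc'.le
        _ = ‖c • P‖ := by field_simp
  norm_triangle P Q := norm_le_of_forall _ fun x hx =>
    (norm_add_le _ _).trans (add_le_add (P.norm_apply_le hx) (Q.norm_apply_le hx))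
  norm_eq_zero_iff P := by
    constructor
    · intro h
      apply DFunLike.ext
      intro x
      have h0 : ∀ y : X, ‖y‖ ≤ 1 → P y = 0 := fun y hy =>
        norm_le_zero_iff.1 (h ▸ P.norm_apply_le hy)
      by_cases hx : x = 0
      · exact h0 x (by simp [hx])
      · have hn : ((‖x‖ : ℝ) : 𝕜) ≠ 0 := by simpa using hx
        have hy : P (((‖x‖ : ℝ) : 𝕜)⁻¹ • x) = 0 := h0 _ (by
          rw [norm_smul, norm_inv, RCLike.norm_ofReal, abs_norm]
          exact (inv_mul_cancel₀ (norm_ne_zero_iff.2 hx)).le)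
        have := P.map_smul ((‖x‖ : ℝ) : 𝕜) (((‖x‖ : ℝ) : 𝕜)⁻¹ • x)
        rw [smul_inv_smul₀ hn, hy, smul_zero] at this
        simpa using this
    · rintro rfl
      exact le_antisymm (norm_le_of_forall _ fun x _ => by simp) (norm_nonneg' _)

noncomputable instance : NormedAddCommGroup (HomPoly 𝕜 m X Y) :=
  NormedAddCommGroup.ofCore (𝕜 := 𝕜) normedSpaceCore

noncomputable instance : NormedSpace 𝕜 (HomPoly 𝕜 m X Y) :=
  NormedSpace.ofCore normedSpaceCore

/-- The rank of `P`: the dimension of the linear span of `P(X)`. -/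
noncomputable def rank (P : HomPoly 𝕜 m X Y) : Cardinal :=
  Module.rank 𝕜 (Submodule.span 𝕜 (Set.range P))

/-- `P` is compact if it maps the closed unit ball to a relatively compact set. -/
def IsCompactPoly (P : HomPoly 𝕜 m X Y) : Prop :=
  IsCompact (closure (P '' Metric.closedBall (0 : X) 1))

/-- The `n`-th approximation number `ã_n(P)` (meaningful for `n ≥ 1`). -/
noncomputable def approxNumber (n : ℕ) (P : HomPoly 𝕜 m X Y) : ℝ :=
  sInf {r : ℝ | ∃ Q : HomPoly 𝕜 m X Y, Q.rank < (n : Cardinal) ∧ r = ‖P - Q‖}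

/-- The scalar polynomial `φ ∘ P`, for `φ` in the dual of `Y`. -/
def compDual (P : HomPoly 𝕜 m X Y) (φ : StrongDual 𝕜 Y) : HomPoly 𝕜 m X 𝕜 where
  toFun x := φ (P x)
  exists_multilinear' := by
    obtain ⟨A, hA⟩ := P.exists_multilinear
    exact ⟨φ.compContinuousMultilinearMap A, fun x => by simp [hA]⟩

@[simp] theorem compDual_apply (P : HomPoly 𝕜 m X Y) (φ : StrongDual 𝕜 Y) (x : X) :
    P.compDual φ x = φ (P x) := rfl

/-- The adjoint `P* : Y* → 𝒫(ᵐX)`, `P*(φ)(x) = φ(P(x))`, a continuous linear operator. -/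
noncomputable def adjoint (P : HomPoly 𝕜 m X Y) : StrongDual 𝕜 Y →L[𝕜] HomPoly 𝕜 m X 𝕜 :=
  LinearMap.mkContinuous
    { toFun := P.compDual
      map_add' := fun _ _ => rfl
      map_smul' := fun _ _ => rfl }
    ‖P‖ fun φ => norm_le_of_forall _ fun x hx => by
      rw [mul_comm]
      exact (φ.le_opNorm _).trans
        (mul_le_mul_of_nonneg_left (P.norm_apply_le hx) (norm_nonneg φ))

@[simp] theorem adjoint_apply (P : HomPoly 𝕜 m X Y) (φ : StrongDual 𝕜 Y) (x : X) :
    P.adjoint φ x = φ (P x) := rfl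

end HomPoly

/-- The `n`-th approximation number `a_n(T)` of a continuous linear operator
(meaningful for `n ≥ 1`). -/
noncomputable def ContinuousLinearMap.approxNumber {𝕜 E F : Type*} [RCLike 𝕜]
    [NormedAddCommGroup E] [NormedSpace 𝕜 E] [NormedAddCommGroup F] [NormedSpace 𝕜 F]
    (n : ℕ) (T : E →L[𝕜] F) : ℝ :=
  sInf {r : ℝ | ∃ L : E →L[𝕜] F, LinearMap.rank (L : E →ₗ[𝕜] F) < (n : Cardinal) ∧ r = ‖T - L‖}

/-! Taking adjoints is linear and increases neither norm nor rank, so `a_n(P*) ≤ ã_n(P)`.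
Conversely, an `L` of rank less than `n` has the form `φ ↦ ∑ F_l(φ) p_l` with `F_l` in the bidual of
`Y`; it would be an adjoint if the `F_l` came from vectors of `Y`.

A Helly-type separation argument supplies vectors `u_l`, with `‖u_l‖ ≤ ‖F_l‖ + 1`, such that `∑
p_l(x) u_l` is within `‖P* - L‖ + ε` of `P x` at finitely many points of the ball. These points form
a net on which the bounded scalar maps `p_l` vary little. For compact `P` the net also controls `P`,
and nothing is lost. In general, comparison through `L` bounds the oscillation of `P` by about `2‖P*
- L‖`, which gives the constant 3, better than 5. -/

open RCLike in
/-- A functional almost attains its norm on balls. -/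
theorem exists_norm_lt_le_re_apply {𝕜 : Type*} [RCLike 𝕜] {Y : Type*} [NormedAddCommGroup Y]
    [NormedSpace 𝕜 Y] (φ : StrongDual 𝕜 Y) {s r : ℝ} (hs : 0 ≤ s) (hsr : s < r) :
    ∃ z : Y, ‖z‖ < r ∧ s * ‖φ‖ ≤ re (φ z) := by
  have hr : 0 < r := hs.trans_lt hsr
  by_cases h0 : ‖φ‖ = 0
  · exact ⟨0, by simpa using hr, by simp [h0]⟩
  have hpos : 0 < ‖φ‖ := lt_of_le_of_ne (norm_nonneg φ) (Ne.symm h0)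
  have hlt : s / r * ‖φ‖ < ‖φ‖ := by
    have : s / r < 1 := (div_lt_one hr).2 hsr
    nlinarith
  obtain ⟨x, hx, hφx⟩ := φ.exists_lt_apply_of_lt_opNorm hlt
  obtain ⟨c, hc, hcx⟩ := RCLike.exists_norm_eq_mul_self (φ x)
  -- The unimodular `c` rotates `φ x` onto the nonnegative reals; `r` rescales the unit ball.
  refine ⟨((r : 𝕜) * c) • x, ?_, ?_⟩
  · rw [norm_smul, norm_mul, hc, RCLike.norm_ofReal, abs_of_pos hr]
    nlinarith
  · rw [_root_.map_smul, smul_eq_mul, mul_assoc, ← hcx, ← RCLike.ofReal_mul, RCLike.ofReal_re]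
    calc s * ‖φ‖ = r * (s / r * ‖φ‖) := by field_simp
      _ ≤ r * ‖φ x‖ := mul_le_mul_of_nonneg_left hφx.le hr.le

open RCLike Pointwise in
/-- A Helly-type theorem: linear functionals on the dual that satisfy finitely many norm
constraints can be replaced by vectors of the space satisfying slightly relaxed constraints. -/
theorem exists_forall_norm_sub_sum_smul_lt {𝕜 : Type*} [RCLike 𝕜] {Y : Type*}
    [NormedAddCommGroup Y] [NormedSpace 𝕜 Y] {ι κ : Type*} [Finite ι] [Fintype κ]
    (F : κ → StrongDual 𝕜 Y →ₗ[𝕜] 𝕜) (y : ι → Y) (c : ι → κ → 𝕜) {s r : ι → ℝ}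
    (hs : ∀ j, 0 ≤ s j) (hsr : ∀ j, s j < r j)
    (h : ∀ j φ, ‖φ (y j) - ∑ l, c j l * F l φ‖ ≤ s j * ‖φ‖) :
    ∃ u : κ → Y, ∀ j, ‖y j - ∑ l, c j l • u l‖ < r j := by
  classical
  have := Fintype.ofFinite ι
  let _ : NormedSpace ℝ Y := NormedSpace.restrictScalars ℝ 𝕜 Y
  have : IsScalarTower ℝ 𝕜 Y := inferInstance
  let A : (κ → Y) →ₗ[𝕜] (ι → Y) :=
    LinearMap.pi fun j => ∑ l, c j l • (LinearMap.proj l : (κ → Y) →ₗ[𝕜] Y)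
  have hA : ∀ u j, A u j = ∑ l, c j l • u l := fun u j => by simp [A]
  let B : Set (ι → Y) := Set.univ.pi fun j => Metric.ball 0 (r j)
  -- The required `u` exists exactly when `y` lies in this open convex set; otherwise Hahn–Banach
  -- separates.
  let S : Set (ι → Y) := (LinearMap.range (A.restrictScalars ℝ) : Set (ι → Y)) + B
  by_contra hne
  have hyS : y ∉ S := by
    rintro ⟨_, ⟨u, rfl⟩, b, hb, hy⟩
    refine hne ⟨u, fun j => ?_⟩
    have hbj : ‖b j‖ < r j := by simpa using hb j (Set.mem_univ j)
    have hyj : A u j + b j = y j := congrFun hy j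
    rwa [← hA, ← hyj, add_sub_cancel_left]
  have hSc : Convex ℝ S :=
    (Submodule.convex _).add (convex_pi fun j _ => convex_ball _ _)
  have hSo : IsOpen S := (isOpen_set_pi Set.finite_univ fun j _ => Metric.isOpen_ball).add_left
  obtain ⟨f, hf⟩ := RCLike.geometric_hahn_banach_open_point (𝕜 := 𝕜) hSc hSo hyS
  have hmem : ∀ u, ∀ b ∈ B, re (f (A u)) + re (f b) < re (f y) := fun u b hb => by
    have := hf _ (Set.add_mem_add (LinearMap.mem_range_self (A.restrictScalars ℝ) u) hb)
    simpa using this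
  have hB0 : (0 : ι → Y) ∈ B := fun j _ => by simpa using (hs j).trans_lt (hsr j)
  have hfA : ∀ u, f (A u) = 0 := fun u => by
    by_contra h0
    have hpos : 0 < ‖f (A u)‖ ^ 2 := by positivity
    -- The scalar makes the left side equal to `re (f y)`, contradicting the strict separation.
    have := hmem (((re (f y) / ‖f (A u)‖ ^ 2 : ℝ) * (starRingEnd 𝕜) (f (A u))) • u) 0 hB0
    rw [_root_.map_smul, _root_.map_smul, smul_eq_mul, mul_assoc, RCLike.conj_mul,
      ← RCLike.ofReal_pow, ← RCLike.ofReal_mul, RCLike.ofReal_re, map_zero, map_zero, add_zero,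
      div_mul_cancel₀ _ hpos.ne'] at this
    exact lt_irrefl _ this
  let φ : ι → StrongDual 𝕜 Y := fun j => f.comp (ContinuousLinearMap.single 𝕜 (fun _ => Y) j)
  have hφ : ∀ z, f z = ∑ j, φ j (z j) := fun z => by
    conv_lhs => rw [← Finset.univ_sum_single z]
    simp [φ]
  -- Vanishing on the range of `A` is a linear relation between the `φ j`; applying `F l` to it
  -- removes every `F` term from the sum of the hypotheses.
  have hφc : ∀ l, ∑ j, c j l • φ j = 0 := fun l => by
    ext v
    have := hfA (Pi.single l v)
    rw [hφ] at this
    simpa [hA, Pi.single_apply] using this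
  choose z hz hzφ using fun j => exists_norm_lt_le_re_apply (φ j) (hs j) (hsr j)
  have h1 := hmem 0 z fun j _ => by simpa using hz j
  have h2 : ∑ j, ∑ l, c j l * F l (φ j) = 0 := by
    rw [Finset.sum_comm]
    refine Finset.sum_eq_zero fun l _ => ?_
    simpa using congrArg (F l) (hφc l)
  have h3 : f y = ∑ j, (φ j (y j) - ∑ l, c j l * F l (φ j)) := by
    rw [Finset.sum_sub_distrib, h2, sub_zero, hφ]
  have h4 : re (f y) ≤ re (f z) := by
    rw [h3, hφ z, map_sum, map_sum]
    exact Finset.sum_le_sum fun j _ =>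
      ((RCLike.re_le_norm _).trans (h j (φ j))).trans (hzφ j)
  simp only [map_zero, zero_add] at h1
  exact absurd h4 (not_le.2 h1)

/-! ### Finite-rank polynomials and their adjoints -/

namespace HomPoly

variable {𝕜 : Type*} [RCLike 𝕜] {m : ℕ} {X Y : Type*}
  [NormedAddCommGroup X] [NormedSpace 𝕜 X] [NormedAddCommGroup Y] [NormedSpace 𝕜 Y]

theorem sum_apply {κ : Type*} (s : Finset κ) (P : κ → HomPoly 𝕜 m X Y) (x : X) :
    (∑ l ∈ s, P l) x = ∑ l ∈ s, P l x := by
  have := congrFun (map_sum (coeAddHom : HomPoly 𝕜 m X Y →+ (X → Y)) P s) x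
  rwa [Finset.sum_apply] at this

/-- The polynomial `x ↦ p x • u` of rank at most one. -/
def smulRight (p : HomPoly 𝕜 m X 𝕜) (u : Y) : HomPoly 𝕜 m X Y where
  toFun x := p x • u
  exists_multilinear' := by
    obtain ⟨A, hA⟩ := p.exists_multilinear
    exact ⟨A.smulRight u, fun x => by simp [hA]⟩

@[simp] theorem smulRight_apply (p : HomPoly 𝕜 m X 𝕜) (u : Y) (x : X) :
    p.smulRight u x = p x • u := rfl

theorem rank_sum_smulRight_le {k : ℕ} (p : Fin k → HomPoly 𝕜 m X 𝕜) (u : Fin k → Y) :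
    (∑ l, (p l).smulRight (u l)).rank ≤ k := by
  have hle : Submodule.span 𝕜 (Set.range (∑ l, (p l).smulRight (u l) : HomPoly 𝕜 m X Y)) ≤
      Submodule.span 𝕜 (Set.range u) := by
    refine Submodule.span_le.2 ?_
    rintro _ ⟨x, rfl⟩
    rw [sum_apply]
    exact Submodule.sum_mem _ fun l _ =>
      Submodule.smul_mem _ _ (Submodule.subset_span ⟨l, rfl⟩)
  have := FiniteDimensional.span_of_finite 𝕜 (Set.finite_range u)
  refine (Submodule.rank_mono hle).trans ?_
  rw [← Module.finrank_eq_rank]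
  exact_mod_cast (finrank_range_le_card u).trans_eq (Fintype.card_fin k)

theorem rank_zero : (0 : HomPoly 𝕜 m X Y).rank = 0 := by
  have : Submodule.span 𝕜 (Set.range (0 : HomPoly 𝕜 m X Y)) = ⊥ :=
    Submodule.span_eq_bot.2 (by rintro _ ⟨x, rfl⟩; rfl)
  rw [rank, this, rank_bot]

theorem norm_adjoint_le (P : HomPoly 𝕜 m X Y) : ‖P.adjoint‖ ≤ ‖P‖ :=
  LinearMap.mkContinuous_norm_le _ P.norm_nonneg' _

theorem adjoint_sub (P Q : HomPoly 𝕜 m X Y) : (P - Q).adjoint = P.adjoint - Q.adjoint := by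
  ext φ
  exact DFunLike.ext _ _ fun x => φ.map_sub _ _

theorem rank_adjoint_lt {n : ℕ} {Q : HomPoly 𝕜 m X Y} (hQ : Q.rank < n) :
    LinearMap.rank (Q.adjoint : StrongDual 𝕜 Y →ₗ[𝕜] HomPoly 𝕜 m X 𝕜) < n := by
  let V := Submodule.span 𝕜 (Set.range Q)
  have : FiniteDimensional 𝕜 V :=
    Module.rank_lt_aleph0_iff.1 (hQ.trans Cardinal.natCast_lt_aleph0)
  let b := Module.finBasis 𝕜 V
  -- Coordinates on the span of `Q(X)` extend to `Y` by Hahn–Banach, so the `Q.adjoint (ψ l)` span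
  -- the range of the adjoint.
  choose ψ hψ _ using fun l => exists_extension_norm_eq V (LinearMap.toContinuousLinearMap (b.coord l))
  have hle : LinearMap.range (Q.adjoint : StrongDual 𝕜 Y →ₗ[𝕜] HomPoly 𝕜 m X 𝕜) ≤
      Submodule.span 𝕜 (Set.range fun l => Q.adjoint (ψ l)) := by
    rintro _ ⟨φ, rfl⟩
    have : Q.adjoint φ = ∑ l, φ (b l) • Q.adjoint (ψ l) := by
      refine DFunLike.ext _ _ fun x => ?_
      let v : V := ⟨Q x, Submodule.subset_span ⟨x, rfl⟩⟩
      have hv : (∑ l, b.repr v l • (b l : Y)) = Q x := by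
        have := congrArg V.subtype (b.sum_repr v)
        rwa [map_sum] at this
      rw [sum_apply, adjoint_apply]
      conv_lhs => rw [← hv]
      rw [map_sum]
      refine Finset.sum_congr rfl fun l _ => ?_
      rw [smul_apply, adjoint_apply, _root_.map_smul, smul_eq_mul, smul_eq_mul, mul_comm]
      congr 1
      exact (hψ l v).symm
    rw [ContinuousLinearMap.coe_coe, this]
    exact Submodule.sum_mem _ fun l _ =>
      Submodule.smul_mem _ _ (Submodule.subset_span ⟨l, rfl⟩)
  refine (Submodule.rank_mono hle).trans_lt ?_
  have := FiniteDimensional.span_of_finite 𝕜 (Set.finite_range fun l => Q.adjoint (ψ l))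
  rw [← Module.finrank_eq_rank]
  have h1 := finrank_range_le_card (R := 𝕜) fun l => Q.adjoint (ψ l)
  rw [Fintype.card_fin] at h1
  have h2 : Module.finrank 𝕜 V < n := Module.finrank_lt_of_rank_lt hQ
  exact_mod_cast h1.trans_lt h2

/-- Coordinates of an operator of finite rank into the space of scalar polynomials. -/
theorem exists_coords_of_rank_lt {E : Type*} [NormedAddCommGroup E] [NormedSpace 𝕜 E] {n : ℕ}
    {L : E →L[𝕜] HomPoly 𝕜 m X 𝕜} (hL : LinearMap.rank (L : E →ₗ[𝕜] HomPoly 𝕜 m X 𝕜) < n) :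
    ∃ (k : ℕ) (p : Fin k → HomPoly 𝕜 m X 𝕜) (F : Fin k → StrongDual 𝕜 E), k < n ∧
      ∀ φ x, L φ x = ∑ l, p l x * F l φ := by
  let V := LinearMap.range (L : E →ₗ[𝕜] HomPoly 𝕜 m X 𝕜)
  have : FiniteDimensional 𝕜 V :=
    Module.rank_lt_aleph0_iff.1 (LT.lt.trans hL Cardinal.natCast_lt_aleph0)
  let b := Module.finBasis 𝕜 V
  let R : E →L[𝕜] V := L.codRestrict V fun φ => ⟨φ, rfl⟩
  refine ⟨Module.finrank 𝕜 V, fun l => b l,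
    fun l => (LinearMap.toContinuousLinearMap (b.coord l)).comp R,
    Module.finrank_lt_of_rank_lt hL, fun φ x => ?_⟩
  have hv : ∑ l, b.repr (R φ) l • (b l : HomPoly 𝕜 m X 𝕜) = L φ := by
    have := congrArg V.subtype (b.sum_repr (R φ))
    rwa [map_sum] at this
  conv_lhs => rw [← hv]
  rw [sum_apply]
  exact Finset.sum_congr rfl fun l _ => mul_comm _ _

/-- Replacing the bidual by the space on a finite net: the common core of both estimates. -/
theorem exists_coeffs_near {k : ℕ} (P : HomPoly 𝕜 m X Y)
    (L : StrongDual 𝕜 Y →L[𝕜] HomPoly 𝕜 m X 𝕜) (p : Fin k → HomPoly 𝕜 m X 𝕜)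
    (F : Fin k → StrongDual 𝕜 (StrongDual 𝕜 Y)) (hL : ∀ φ x, L φ x = ∑ l, p l x * F l φ)
    {t : Set X} (ht : t.Finite) (hball : ∀ x ∈ t, ‖x‖ ≤ 1) {ε : ℝ} (hε : 0 < ε) :
    ∃ u : Fin k → Y, (∀ l, ‖u l‖ ≤ ‖F l‖ + 1) ∧
      ∀ x ∈ t, ‖P x - ∑ l, p l x • u l‖ ≤ ‖P.adjoint - L‖ + ε := by
  classical
  have := ht.to_subtype
  -- Points of `t` give the approximation constraints. The indices in `Fin k`, with target `0` and a
  -- unit coefficient vector, bound each `‖u l‖` independently of `t`.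
  obtain ⟨u, hu⟩ := exists_forall_norm_sub_sum_smul_lt (ι := t ⊕ Fin k)
    (fun l => (F l : StrongDual 𝕜 Y →ₗ[𝕜] 𝕜)) (Sum.elim (fun x => P x) fun _ => 0)
    (Sum.elim (fun x l => p l x) fun i => Pi.single i 1)
    (s := Sum.elim (fun _ => ‖P.adjoint - L‖) fun i => ‖F i‖)
    (r := Sum.elim (fun _ => ‖P.adjoint - L‖ + ε) fun i => ‖F i‖ + 1)
    (by rintro (x | i); exacts [norm_nonneg (P.adjoint - L), norm_nonneg (F i)])
    (by rintro (x | i) <;> simp [hε])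
    (by
      rintro (x | i) φ
      · have := ((P.adjoint - L) φ).norm_apply_le (hball x x.2)
        have h2 : ((P.adjoint - L) φ) x = φ (P x) - ∑ l, p l x * F l φ := by
          rw [← hL]; rfl
        rw [h2] at this
        exact this.trans ((P.adjoint - L).le_opNorm φ)
      · simpa [Pi.single_apply] using (F i).le_opNorm φ)
  refine ⟨u, fun l => ?_, fun x hx => (hu (Sum.inl ⟨x, hx⟩)).le⟩
  simpa [Pi.single_apply] using (hu (Sum.inr l)).le

end HomPoly

/-! ### From finite nets to the unit ball -/

theorem exists_finite_net_of_totallyBounded_image {α β : Type*} [PseudoMetricSpace β] {f : α → β}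
    {s : Set α} (h : TotallyBounded (f '' s)) {δ : ℝ} (hδ : 0 < δ) :
    ∃ t ⊆ s, t.Finite ∧ ∀ x ∈ s, ∃ x' ∈ t, dist (f x) (f x') < δ := by
  obtain ⟨T, hTs, hT, hcov⟩ := Metric.finite_approx_of_totallyBounded h δ hδ
  obtain ⟨t, hts, ht, rfl⟩ := Set.exists_subset_image_finite_and.1 ⟨T, hTs, hT, rfl⟩
  refine ⟨t, hts, ht, fun x hx => ?_⟩
  simpa using hcov ⟨x, hx, rfl⟩

namespace HomPoly

variable {𝕜 : Type*} [RCLike 𝕜] {m : ℕ} {X Y : Type*}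
  [NormedAddCommGroup X] [NormedSpace 𝕜 X] [NormedAddCommGroup Y] [NormedSpace 𝕜 Y]

theorem isCompact_closure_coords_image {k : ℕ} (p : Fin k → HomPoly 𝕜 m X 𝕜) :
    IsCompact (closure ((fun x l => p l x) '' Metric.closedBall (0 : X) 1)) := by
  refine (isCompact_univ_pi fun l => isCompact_closedBall (0 : 𝕜) ‖p l‖).closure_of_subset ?_
  rintro _ ⟨x, hx, rfl⟩ l -
  simpa using (p l).norm_apply_le (by simpa using hx)

theorem norm_sum_sub_smul_le {k : ℕ} (p : Fin k → HomPoly 𝕜 m X 𝕜) (u : Fin k → Y)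
    {x x' : X} {δ : ℝ} (hx : ∀ l, ‖p l x - p l x'‖ ≤ δ) :
    ‖∑ l, (p l x - p l x') • u l‖ ≤ δ * ∑ l, ‖u l‖ := by
  rw [Finset.mul_sum]
  refine (norm_sum_le _ _).trans (Finset.sum_le_sum fun l _ => ?_)
  rw [norm_smul]
  exact mul_le_mul_of_nonneg_right (hx l) (norm_nonneg _)

/-- Two values of `P` are close when the values of a finite-rank approximation of `P.adjoint`
are. -/
theorem norm_apply_sub_apply_le {k : ℕ} (P : HomPoly 𝕜 m X Y)
    (L : StrongDual 𝕜 Y →L[𝕜] HomPoly 𝕜 m X 𝕜) (p : Fin k → HomPoly 𝕜 m X 𝕜)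
    (F : Fin k → StrongDual 𝕜 (StrongDual 𝕜 Y)) (hL : ∀ φ x, L φ x = ∑ l, p l x * F l φ)
    {x x' : X} (hx : ‖x‖ ≤ 1) (hx' : ‖x'‖ ≤ 1) {δ : ℝ} (hδ : 0 ≤ δ)
    (hxx' : ∀ l, ‖p l x - p l x'‖ ≤ δ) :
    ‖P x - P x'‖ ≤ 2 * ‖P.adjoint - L‖ + δ * ∑ l, ‖F l‖ := by
  have key : ∀ φ z, ‖z‖ ≤ 1 → ‖φ (P z) - L φ z‖ ≤ ‖P.adjoint - L‖ * ‖φ‖ := fun φ z hz =>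
    (((P.adjoint - L) φ).norm_apply_le hz).trans ((P.adjoint - L).le_opNorm φ)
  refine NormedSpace.norm_le_dual_bound 𝕜 _ (by positivity) fun φ => ?_
  have h0 : φ (P x - P x') = (φ (P x) - L φ x) - (φ (P x') - L φ x') +
      (∑ l, (p l x - p l x') • F l) φ := by
    have : (∑ l, (p l x - p l x') • F l) φ = L φ x - L φ x' := by
      rw [hL, hL, ← Finset.sum_sub_distrib]
      simp [sub_mul]
    rw [this, map_sub]
    ring
  have h3 := ((∑ l, (p l x - p l x') • F l).le_opNorm φ).trans
    (mul_le_mul_of_nonneg_right (norm_sum_sub_smul_le p F hxx') (norm_nonneg φ))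
  rw [h0]
  refine (norm_add_le _ _).trans ?_
  have h4 := norm_sub_le (φ (P x) - L φ x) (φ (P x') - L φ x')
  linarith [key φ x hx, key φ x' hx']

/-- If `C` controls the oscillation of `P` on nets of the unit ball that are fine for finitely many
scalar polynomials, then finite-rank approximations of the adjoint give ones of `P`. -/
theorem exists_rank_lt_norm_sub_le {n : ℕ} (P : HomPoly 𝕜 m X Y)
    {L : StrongDual 𝕜 Y →L[𝕜] HomPoly 𝕜 m X 𝕜}
    (hLn : LinearMap.rank (L : StrongDual 𝕜 Y →ₗ[𝕜] HomPoly 𝕜 m X 𝕜) < n) {C ε : ℝ}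
    (hε : 0 < ε)
    (hC : ∀ (k : ℕ) (p : Fin k → HomPoly 𝕜 m X 𝕜) (F : Fin k → StrongDual 𝕜 (StrongDual 𝕜 Y)),
      (∀ φ x, L φ x = ∑ l, p l x * F l φ) → ∀ η > 0, ∃ δ > 0, δ ≤ η ∧
        ∃ t ⊆ Metric.closedBall (0 : X) 1, t.Finite ∧ ∀ x ∈ Metric.closedBall (0 : X) 1,
          ∃ x' ∈ t, (∀ l, ‖p l x - p l x'‖ ≤ δ) ∧ ‖P x - P x'‖ ≤ C + ε) :
    ∃ Q : HomPoly 𝕜 m X Y, Q.rank < n ∧ ‖P - Q‖ ≤ ‖P.adjoint - L‖ + C + 3 * ε := by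
  obtain ⟨k, p, F, hk, hL⟩ := exists_coords_of_rank_lt hLn
  have hS : 0 < ∑ l, (‖F l‖ + 1) + 1 := by positivity
  -- The mesh must be fixed before `u` exists; this is possible because the bound on `‖u l‖`
  -- involves only `F`.
  obtain ⟨δ, hδ, hδη, t, htb, ht, hnet⟩ := hC k p F hL (ε / (∑ l, (‖F l‖ + 1) + 1)) (by positivity)
  have hδε : δ * (∑ l, (‖F l‖ + 1) + 1) ≤ ε := (le_div_iff₀ hS).1 hδη
  obtain ⟨u, hu, hut⟩ := exists_coeffs_near P L p F hL ht (fun x hx => by simpa using htb hx) hε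
  have hus : ∑ l, ‖u l‖ ≤ ∑ l, (‖F l‖ + 1) := Finset.sum_le_sum fun l _ => hu l
  refine ⟨∑ l, (p l).smulRight (u l),
    (rank_sum_smulRight_le p u).trans_lt (by exact_mod_cast hk), norm_le_of_forall _ fun x hx => ?_⟩
  obtain ⟨x', hx't, hp, hP⟩ := hnet x (by simpa using hx)
  have h1 := hut x' hx't
  have h2 := norm_sum_sub_smul_le p u hp
  have h3 : (P - ∑ l, (p l).smulRight (u l)) x = (P x - P x') + (P x' - ∑ l, p l x' • u l) -
      ∑ l, (p l x - p l x') • u l := by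
    simp only [sub_apply, sum_apply, smulRight_apply, sub_smul, Finset.sum_sub_distrib]
    abel
  rw [h3]
  have h4 : δ * ∑ l, ‖u l‖ ≤ ε := by nlinarith
  have h5 := norm_sub_le ((P x - P x') + (P x' - ∑ l, p l x' • u l)) (∑ l, (p l x - p l x') • u l)
  have h6 := norm_add_le (P x - P x') (P x' - ∑ l, p l x' • u l)
  linarith

/-- A net for the `p l` alone suffices: points with nearby coordinates have values of `P` within
`2‖P.adjoint - L‖ + ε`. -/
theorem exists_rank_lt_norm_sub_le_three_mul {n : ℕ} (P : HomPoly 𝕜 m X Y)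
    {L : StrongDual 𝕜 Y →L[𝕜] HomPoly 𝕜 m X 𝕜}
    (hLn : LinearMap.rank (L : StrongDual 𝕜 Y →ₗ[𝕜] HomPoly 𝕜 m X 𝕜) < n) {ε : ℝ} (hε : 0 < ε) :
    ∃ Q : HomPoly 𝕜 m X Y, Q.rank < n ∧ ‖P - Q‖ ≤ 3 * ‖P.adjoint - L‖ + 3 * ε := by
  obtain ⟨Q, hQ, h⟩ := P.exists_rank_lt_norm_sub_le hLn (C := 2 * ‖P.adjoint - L‖) hε (by
    intro k p F hL η hη
    have hS : 0 < ∑ l, ‖F l‖ + 1 := by positivity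
    have hδ : 0 < min η (ε / (∑ l, ‖F l‖ + 1)) := lt_min hη (by positivity)
    obtain ⟨t, htb, ht, hnet⟩ :=
      exists_finite_net_of_totallyBounded_image
        ((isCompact_closure_coords_image p).totallyBounded.subset subset_closure) hδ
    refine ⟨_, hδ, min_le_left _ _, t, htb, ht, fun x hx => ?_⟩
    obtain ⟨x', hx', hd⟩ := hnet x hx
    have hp : ∀ l, ‖p l x - p l x'‖ ≤ min η (ε / (∑ l, ‖F l‖ + 1)) := fun l => by
      rw [← dist_eq_norm]
      exact (dist_le_pi_dist (fun l => p l x) (fun l => p l x') l).trans hd.le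
    refine ⟨x', hx', hp, ?_⟩
    have h1 := norm_apply_sub_apply_le P L p F hL (by simpa using hx) (by simpa using htb hx')
      hδ.le hp
    have h2 := (le_div_iff₀ hS).1 (min_le_right η (ε / (∑ l, ‖F l‖ + 1)))
    nlinarith)
  exact ⟨Q, hQ, by linarith⟩

/-- Compactness allows one net to serve `P` and all the `p l` at once, so the oscillation term `C`
is zero. -/
theorem IsCompactPoly.exists_rank_lt_norm_sub_le {n : ℕ} {P : HomPoly 𝕜 m X Y}
    (hP : P.IsCompactPoly) {L : StrongDual 𝕜 Y →L[𝕜] HomPoly 𝕜 m X 𝕜}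
    (hLn : LinearMap.rank (L : StrongDual 𝕜 Y →ₗ[𝕜] HomPoly 𝕜 m X 𝕜) < n) {ε : ℝ} (hε : 0 < ε) :
    ∃ Q : HomPoly 𝕜 m X Y, Q.rank < n ∧ ‖P - Q‖ ≤ ‖P.adjoint - L‖ + 3 * ε := by
  obtain ⟨Q, hQ, h⟩ := HomPoly.exists_rank_lt_norm_sub_le P hLn (C := 0) hε (by
    intro k p F _ η hη
    have htb : TotallyBounded
        ((fun x => (P x, fun l => p l x)) '' Metric.closedBall (0 : X) 1) := by
      refine (hP.prod (isCompact_closure_coords_image p)).totallyBounded.subset ?_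
      rintro _ ⟨x, hx, rfl⟩
      exact ⟨subset_closure ⟨x, hx, rfl⟩, subset_closure ⟨x, hx, rfl⟩⟩
    have hδ : 0 < min η ε := lt_min hη hε
    obtain ⟨t, htb, ht, hnet⟩ := exists_finite_net_of_totallyBounded_image htb hδ
    refine ⟨_, hδ, min_le_left _ _, t, htb, ht, fun x hx => ?_⟩
    obtain ⟨x', hx', hd⟩ := hnet x hx
    obtain ⟨h1, h2⟩ := max_lt_iff.1 hd
    refine ⟨x', hx', fun l => ?_, ?_⟩
    · rw [← dist_eq_norm]
      exact (dist_le_pi_dist (fun l => p l x) (fun l => p l x') l).trans h2.le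
    · rw [← dist_eq_norm, zero_add]
      exact h1.le.trans (min_le_right _ _))
  exact ⟨Q, hQ, by linarith⟩

/-! ### Comparison of approximation numbers -/

theorem approxNumber_le {n : ℕ} {P Q : HomPoly 𝕜 m X Y} (hQ : Q.rank < n) :
    P.approxNumber n ≤ ‖P - Q‖ :=
  csInf_le ⟨0, by rintro _ ⟨Q, -, rfl⟩; exact norm_nonneg _⟩ ⟨Q, hQ, rfl⟩

theorem approxNumber_adjoint_le {n : ℕ} (hn : 1 ≤ n) (P : HomPoly 𝕜 m X Y) :
    P.adjoint.approxNumber n ≤ P.approxNumber n := by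
  refine le_csInf ⟨_, 0, by rw [rank_zero]; exact_mod_cast hn, rfl⟩ ?_
  rintro _ ⟨Q, hQ, rfl⟩
  calc P.adjoint.approxNumber n ≤ ‖P.adjoint - Q.adjoint‖ :=
        csInf_le ⟨0, by rintro _ ⟨L, -, rfl⟩; exact norm_nonneg _⟩
          ⟨Q.adjoint, rank_adjoint_lt hQ, rfl⟩
    _ = ‖(P - Q).adjoint‖ := by rw [adjoint_sub]
    _ ≤ ‖P - Q‖ := norm_adjoint_le _

theorem le_approxNumber_of_forall {E G : Type*} [NormedAddCommGroup E] [NormedSpace 𝕜 E]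
    [NormedAddCommGroup G] [NormedSpace 𝕜 G] {n : ℕ} (hn : 1 ≤ n) {T : E →L[𝕜] G} {a : ℝ}
    (h : ∀ L : E →L[𝕜] G, LinearMap.rank (L : E →ₗ[𝕜] G) < n → a ≤ ‖T - L‖) :
    a ≤ T.approxNumber n := by
  -- Since `n ≥ 1`, the zero operator is admissible; an empty set would give `sInf` its default
  -- value 0.
  refine le_csInf ⟨_, 0, ?_, rfl⟩ ?_
  · rw [ContinuousLinearMap.toLinearMap_zero, LinearMap.rank_zero]
    exact_mod_cast hn
  · rintro _ ⟨L, hL, rfl⟩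
    exact h L hL

theorem IsCompactPoly.approxNumber_eq {n : ℕ} (hn : 1 ≤ n) {P : HomPoly 𝕜 m X Y}
    (hP : P.IsCompactPoly) : P.approxNumber n = P.adjoint.approxNumber n := by
  refine le_antisymm (le_approxNumber_of_forall hn fun L hL => ?_) (approxNumber_adjoint_le hn P)
  refine le_of_forall_pos_le_add fun ε hε => ?_
  obtain ⟨Q, hQ, h⟩ := hP.exists_rank_lt_norm_sub_le hL (ε := ε / 3) (by positivity)
  linarith [approxNumber_le (P := P) hQ]

theorem approxNumber_le_three_mul {n : ℕ} (hn : 1 ≤ n) (P : HomPoly 𝕜 m X Y) :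
    P.approxNumber n ≤ 3 * P.adjoint.approxNumber n := by
  suffices P.approxNumber n / 3 ≤ P.adjoint.approxNumber n by linarith
  refine le_approxNumber_of_forall hn fun L hL => ?_
  refine le_of_forall_pos_le_add fun ε hε => ?_
  obtain ⟨Q, hQ, h⟩ := P.exists_rank_lt_norm_sub_le_three_mul hL hε
  linarith [approxNumber_le (P := P) hQ]

end HomPoly

theorem corollary4p6 {𝕜 : Type*} [RCLike 𝕜] (m : ℕ) (hm : 2 ≤ m) (X Y : Type*)
    [NormedAddCommGroup X] [NormedSpace 𝕜 X] [CompleteSpace X]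
    [NormedAddCommGroup Y] [NormedSpace 𝕜 Y] [CompleteSpace Y] :
    (∀ P : HomPoly 𝕜 m X Y, P.IsCompactPoly →
      ∀ n : ℕ, 1 ≤ n → HomPoly.approxNumber n P = ContinuousLinearMap.approxNumber n P.adjoint) ∧
    (∀ P : HomPoly 𝕜 m X Y, ∀ n : ℕ, 1 ≤ n →
      HomPoly.approxNumber n P ≤ 5 * ContinuousLinearMap.approxNumber n P.adjoint) := by
  refine ⟨fun P hP n hn => hP.approxNumber_eq hn, fun P n hn => ?_⟩
  -- Nonnegativity is what weakens the constant 3 to 5.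
  have h0 : 0 ≤ P.adjoint.approxNumber n :=
    HomPoly.le_approxNumber_of_forall hn fun _ _ => norm_nonneg _
  linarith [P.approxNumber_le_three_mul hn]
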